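/- Let $g = (g_t)_{t\in\mathbb{Z}}$ be a sequence of complex numbers and let $k \ge 1$ be an integer. For $m,n \ge 1$ and $t \in \mathbb{Z}$ let $H^g(t,m,n) = (g_{t+i+j-2})_{1\le i\le m,\,1\le j\le n}$ be the $m \times n$ Hankel matrix, and let $\mathcal{H}^g$ be the Hankel operator, given by the infinite matrix $(g_{i+j-1})_{i,j\ge 1}$. A matrix $X \in \mathbb{C}^{m\times n}$ with $k \le \min\{m,n\}$ is called $k$-sign consistent if its $k$-minors (the determinants of the $k \times k$ submatrices formed from rows $p_1<\dots<p_k$ and columns $q_1<\dots<q_k$) are all real and either all nonnegative or all nonpositive; it is called strictly $k$-sign consistent if they are all real and either all positive or all negative. The operator $\mathcal{H}^g$ is called (strictly) $k$-sign consistent if $H^g(1,N,N)$ is (strictly) $k$-sign consistent for every $N \ge k$. Then: 1. $\mathcal{H}^g$ is $k$-sign consistent if and only if $H^g(1,k,N)$ is $k$-sign consistent for all $N \ge k$. 2. $\mathcal{H}^g$ is strictly $k$-sign consistent if and only if $H^g(1,k,N)$ is strictly $k$-sign consistent for all $N \ge k$. -/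

import Mathlib

open scoped ComplexOrder

namespace KSign

/-- The `k`-minor of `X` formed from the rows `p 0 < p 1 < ...` and the columns
`q 0 < q 1 < ...`. -/
noncomputable def kMinor {m n k : ℕ} (X : Matrix (Fin m) (Fin n) ℂ)
    (p : Fin k ↪o Fin m) (q : Fin k ↪o Fin n) : ℂ :=
  (X.submatrix p q).det

/-- `X` is `k`-sign consistent: all `k`-minors of `X` are nonnegative, or all are nonpositive.
The order on `ℂ` is the usual partial one: `0 ≤ z` says that `z` is real and nonnegative.
The notion is meant for `1 ≤ k ≤ min m n`. -/
def SignConsistent {m n : ℕ} (k : ℕ) (X : Matrix (Fin m) (Fin n) ℂ) : Prop :=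
  (∀ (p : Fin k ↪o Fin m) (q : Fin k ↪o Fin n), 0 ≤ kMinor X p q) ∨
    (∀ (p : Fin k ↪o Fin m) (q : Fin k ↪o Fin n), kMinor X p q ≤ 0)

/-- `X` is strictly `k`-sign consistent: all `k`-minors of `X` are (real and) positive, or all
are (real and) negative. -/
def StrictlySignConsistent {m n : ℕ} (k : ℕ) (X : Matrix (Fin m) (Fin n) ℂ) : Prop :=
  (∀ (p : Fin k ↪o Fin m) (q : Fin k ↪o Fin n), 0 < kMinor X p q) ∨
    (∀ (p : Fin k ↪o Fin m) (q : Fin k ↪o Fin n), kMinor X p q < 0)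

/-- The Hankel matrix `H^g(t, m, n)`: the `m × n` matrix whose entry in row `i` and column `j`
(both counted from `0`) is `g (t + i + j)`. -/
def hankelMatrix (g : ℤ → ℂ) (t : ℤ) (m n : ℕ) : Matrix (Fin m) (Fin n) ℂ :=
  Matrix.of fun i j => g (t + (i : ℕ) + (j : ℕ))

/-- The Hankel operator of `g`, given by its infinite matrix with rows `(g 1, g 2, g 3, ...)`,
`(g 2, g 3, g 4, ...)`, and so on (rows and columns counted from `0`). -/
def hankelOperator (g : ℤ → ℂ) : Matrix ℕ ℕ ℂ :=
  Matrix.of fun i j => g (1 + (i : ℤ) + (j : ℤ))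

/-- The upper left `N × N` block of an infinite matrix. -/
def leadingBlock (A : Matrix ℕ ℕ ℂ) (N : ℕ) : Matrix (Fin N) (Fin N) ℂ :=
  A.submatrix (fun i => (i : ℕ)) (fun j => (j : ℕ))

/-- The `N × N` leading block of the Hankel operator is the Hankel matrix `H^g(1, N, N)`. -/
theorem leadingBlock_hankelOperator (g : ℤ → ℂ) (N : ℕ) :
    leadingBlock (hankelOperator g) N = hankelMatrix g 1 N N := rfl

/-- An operator given by an infinite matrix is `k`-sign consistent if its `N × N` leading blocks
(for the Hankel operator: the matrices `H^g(1, N, N)`) are `k`-sign consistent for all `N ≥ k`. -/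
def OperatorSignConsistent (k : ℕ) (A : Matrix ℕ ℕ ℂ) : Prop :=
  ∀ N : ℕ, k ≤ N → SignConsistent k (leadingBlock A N)

/-- The strict version of `OperatorSignConsistent`. -/
def OperatorStrictlySignConsistent (k : ℕ) (A : Matrix ℕ ℕ ℂ) : Prop :=
  ∀ N : ℕ, k ≤ N → StrictlySignConsistent k (leadingBlock A N)

end KSign

namespace KSign

/-! Only the passage from `k` rows to all rows needs work. A Hankel minor with consecutive rows is
also a minor with the first `k` columns (`hankelMinor_consecutive`), so the hypothesis controls all
consecutive-row minors, and arbitrary rows must be reached from these. A complex factor `z` carries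
the common sign and absorbs the scalars met on the way.

Strict case, by induction on the order (`hankelMinor_pos`). For fixed columns,
`mul_rowDet_pos_of_consecutive` fills gaps between rows by a Plücker relation, given an auxiliary
vector `e` whose minors with one row fewer have controlled sign. This vector comes from a row at
infinity: the normalised rows `(γ a, γ (a + 1), ...)` and their shifts have a common limit
direction, by variation diminution, so the limit is geometric with some ratio `ρ ≥ 0` or supported
on its last entry. Eliminating it turns minors containing it into Hankel minors of lower order, of
`γ (a + 1) - ρ * γ a` or of `γ`, to which the induction applies.

Weak case, from the strict case of the same order (`hankelMinor_nonneg_of_pos`). If all given minors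
vanish, the rank is less than `k`. Otherwise let `L` be the functional with moments `γ`; for `ε > 0`
and large `T` the sequence `L ((1 + ε X) ^ T * (X + ε) ^ a)` satisfies the strict hypothesis, and it
tends to `γ` as `ε → 0`. -/

/-- The determinant of the matrix with rows `w 0, w 1, ...`. -/
noncomputable abbrev rowDet {n : ℕ} : (Fin n → ℂ) [⋀^Fin n]→ₗ[ℂ] ℂ := Matrix.detRowAlternating

/-! ### Linear and quadratic relations between maximal minors. -/

theorem pos_of_mul_pos_left {u v : ℂ} (hu : 0 < u) (h : 0 < u * v) : 0 < v := by
  have : v = u⁻¹ * (u * v) := by rw [inv_mul_cancel_left₀ hu.ne']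
  rw [this]
  exact mul_pos (RCLike.inv_pos_of_pos hu) h

/-- Bordering the rows by the column of values of `l` gives a singular matrix, since that column is
a combination of the others; the sum is its expansion along that column. -/
theorem sum_neg_one_pow_mul_rowDet {n : ℕ} (x : Fin (n + 1) → Fin n → ℂ)
    (l : (Fin n → ℂ) →ₗ[ℂ] ℂ) :
    ∑ i : Fin (n + 1), (-1) ^ (i : ℕ) * l (x i) * rowDet (fun j => x (i.succAbove j)) = 0 := by
  let A : Matrix (Fin (n + 1)) (Fin (n + 1)) ℂ := Matrix.of fun i => Fin.cons (l (x i)) (x i)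
  have h0 : A.det = 0 := by
    rw [← Matrix.exists_mulVec_eq_zero_iff]
    refine ⟨Fin.cons (-1) (fun j => l (Pi.single j 1)), ?_, ?_⟩
    · intro h
      have := congrFun h 0
      simp at this
    · ext i
      have : l (x i) = ∑ j, x i j * l (Pi.single j 1) := by
        conv_lhs => rw [← LinearMap.sum_single_apply (φ := fun _ => ℂ) (x i)]
        rw [map_sum]
        refine Finset.sum_congr rfl fun j _ => ?_
        rw [← smul_eq_mul, ← map_smul, ← Pi.single_smul, smul_eq_mul, mul_one]
      simp [Matrix.mulVec, dotProduct, Fin.sum_univ_succ, A, this]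
  rw [Matrix.det_succ_column_zero] at h0
  rw [← h0]
  refine Finset.sum_congr rfl fun i _ => ?_
  rfl

theorem map_vecCons_removeNth {V : Type*} [AddCommGroup V] [Module ℂ V] {n : ℕ}
    (f : V [⋀^Fin (n + 1)]→ₗ[ℂ] ℂ) (i : Fin (n + 1)) (y : Fin (n + 1) → V) :
    f (Matrix.vecCons (y i) (fun k => y (i.succAbove k))) = (-1) ^ (i : ℕ) * f y := by
  have h := f.neg_one_pow_smul_map_insertNth i (y i) (i.removeNth y)
  rw [Fin.insertNth_self_removeNth] at h
  change f (Matrix.vecCons (y i) (i.removeNth y)) = _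
  simpa using h.symm

/-- The three-term Plücker relation, for `e`, the first and the last row of `x`, and the interior
row number `j + 1`. -/
theorem rowDet_plucker {d : ℕ} (e : Fin (d + 2) → ℂ) (x : Fin (d + 3) → Fin (d + 2) → ℂ)
    (j : Fin (d + 1)) :
    rowDet (Matrix.vecCons e fun k => x (j.succ.succAbove k).castSucc) *
        rowDet (fun k => x k.succ) +
      rowDet (Matrix.vecCons e fun k => x (j.castSucc.succAbove k).succ) *
        rowDet (fun k => x k.castSucc) =
    rowDet (Matrix.vecCons e fun k => x k.castSucc.succ) *
      rowDet (fun k => x (j.castSucc.succ.succAbove k)) := by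
  let f := (rowDet (n := d + 2)).curryLeft e
  have hf : ∀ w, rowDet (Matrix.vecCons e w) = f w := fun _ => rfl
  -- The interior rows other than number `j + 1`. With `l v` the minor of `e`, `v` and `S`, the
  -- linear relation keeps only its terms for the first row, row `j + 1` and the last row; the
  -- others repeat a row.
  let S : Fin d → Fin (d + 2) → ℂ := fun k => x (j.succAbove k).castSucc.succ
  let l : (Fin (d + 2) → ℂ) →ₗ[ℂ] ℂ :=
    { toFun := fun v => f.curryLeft v S
      map_add' := fun u v => by simp
      map_smul' := fun c v => by simp }
  have hl : ∀ v, l v = f (Matrix.vecCons v S) := fun _ => rfl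
  have key := sum_neg_one_pow_mul_rowDet x l
  rw [Fin.sum_univ_succ, Fin.sum_univ_castSucc, Finset.sum_eq_single j] at key
  · have h1 : l (x 0) = f (fun k => x (j.succ.succAbove k).castSucc) := by
      rw [hl]
      congr 1
      ext k : 1
      refine Fin.cases ?_ (fun k => ?_) k <;> simp [S]
    have h2 : l (x j.castSucc.succ) = (-1) ^ (j : ℕ) * f (fun k => x k.castSucc.succ) := by
      rw [hl, ← map_vecCons_removeNth f j]
    have h3 : l (x (Fin.last (d + 1)).succ) =
        (-1) ^ d * f (fun k => x (j.castSucc.succAbove k).succ) := by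
      rw [hl]
      have := map_vecCons_removeNth f (Fin.last d) (fun k => x (j.castSucc.succAbove k).succ)
      simp only [Fin.succAbove_last, Fin.val_last] at this
      rw [← this]
      congr 1
      ext k : 1
      refine Fin.cases ?_ (fun k => ?_) k
      · simp [Fin.castSucc_ne_last]
      · simp [S, Fin.castSucc_succAbove_castSucc]
    rw [h1, h2, h3] at key
    have e1 : ((-1 : ℂ) ^ (j : ℕ)) * (-1) ^ (j : ℕ) = 1 := by
      rw [← mul_pow]; simp
    have e2 : ((-1 : ℂ) ^ d) * (-1) ^ d = 1 := by
      rw [← mul_pow]; simp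
    simp only [hf]
    simp only [Fin.val_zero, Fin.val_succ, Fin.val_castSucc, Fin.val_last, pow_succ, pow_zero,
      Fin.zero_succAbove, Fin.succ_last, Fin.succAbove_last] at key
    linear_combination key + (f fun k => x k.castSucc.succ) *
      (rowDet (fun k => x (j.castSucc.succ.succAbove k))) * e1 -
      (f fun k => x (j.castSucc.succAbove k).succ) * (rowDet fun k => x k.castSucc) * e2
  · intro i _ hi
    obtain ⟨m, rfl⟩ := Fin.exists_succAbove_eq hi
    have : l (x (j.succAbove m).castSucc.succ) = 0 := by
      rw [hl]
      exact f.map_eq_zero_of_eq _ (i := 0) (j := m.succ) (by simp [S]) (Fin.succ_ne_zero m).symm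
    rw [this]
    simp
  · simp

/-! ### Propagation of positivity between minors. -/

/-- Multilinear expansion of a determinant whose rows are nonnegative combinations of rows of `w`
over sets of indices that weakly increase from row to row. -/
theorem mul_rowDet_sum_smul {n : ℕ} (z : ℂ) (w : ℕ → Fin n → ℂ)
    (hw : ∀ r : Fin n → ℕ, StrictMono r → 0 ≤ z * rowDet (fun i => w (r i)))
    (A : Fin n → Finset ℕ) (hA : ∀ i j, i < j → ∀ s ∈ A i, ∀ t ∈ A j, s ≤ t)
    (c : Fin n → ℕ → ℝ) (hc : ∀ i, ∀ s ∈ A i, 0 ≤ c i s) :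
    0 ≤ z * rowDet (fun i => ∑ s ∈ A i, (c i s : ℂ) • w s) ∧
    ∀ r : Fin n → ℕ, StrictMono r → (∀ i, r i ∈ A i) → (∀ i, 0 < c i (r i)) →
      0 < z * rowDet (fun i => w (r i)) →
      0 < z * rowDet (fun i => ∑ s ∈ A i, (c i s : ℂ) • w s) := by
  classical
  have hexp : z * rowDet (fun i => ∑ s ∈ A i, (c i s : ℂ) • w s) =
      ∑ r ∈ Fintype.piFinset A, ((∏ i, c i (r i) : ℝ) : ℂ) * (z * rowDet (fun i => w (r i))) := by
    have := (rowDet (n := n)).toMultilinearMap.map_sum_finset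
      (fun i s => (c i s : ℂ) • w s) A
    rw [AlternatingMap.coe_multilinearMap] at this
    rw [this, Finset.mul_sum]
    refine Finset.sum_congr rfl fun r _ => ?_
    have := (rowDet (n := n)).toMultilinearMap.map_smul_univ (fun i => (c i (r i) : ℂ))
      (fun i => w (r i))
    rw [AlternatingMap.coe_multilinearMap] at this
    rw [this]
    push_cast
    simp only [smul_eq_mul]
    ring
  have hterm : ∀ r ∈ Fintype.piFinset A,
      0 ≤ ((∏ i, c i (r i) : ℝ) : ℂ) * (z * rowDet (fun i => w (r i))) := by
    intro r hr
    rw [Fintype.mem_piFinset] at hr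
    refine mul_nonneg ?_ ?_
    · exact_mod_cast Finset.prod_nonneg fun i _ => hc i _ (hr i)
    · by_cases hinj : Function.Injective r
      · refine hw r (Monotone.strictMono_of_injective ?_ hinj)
        intro i j hij
        rcases hij.eq_or_lt with rfl | h
        · exact le_rfl
        · exact hA i j h _ (hr i) _ (hr j)
      · rw [Function.Injective] at hinj
        push Not at hinj
        obtain ⟨i, j, hij, hne⟩ := hinj
        rw [AlternatingMap.map_eq_zero_of_eq _ _ (by rw [hij]) hne, mul_zero]
  refine ⟨?_, fun r _ hrA hrc hr => ?_⟩
  · rw [hexp]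
    exact Finset.sum_nonneg hterm
  · rw [hexp]
    refine Finset.sum_pos' hterm ⟨r, Fintype.mem_piFinset.2 hrA, mul_pos ?_ hr⟩
    exact_mod_cast Finset.prod_pos fun i _ => hrc i

/-- Positivity of all maximal minors from that of the ones with consecutive rows and a vector `e`
that plays the role of a row at infinity. -/
theorem mul_rowDet_pos_of_consecutive {n : ℕ} (z : ℂ) (w : ℕ → Fin (n + 1) → ℂ)
    (hcons : ∀ a : ℕ, 0 < z * rowDet (fun i => w (a + i)))
    (e : Fin (n + 1) → ℂ) (z' : ℂ)
    (h0 : ∀ r : Fin n → ℕ, StrictMono r →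
      0 ≤ z' * rowDet (Matrix.vecCons e fun i => w (r i)))
    (h1 : ∀ r : Fin n → ℕ, StrictMono r → (∀ i, 1 ≤ r i) →
      0 < z' * rowDet (Matrix.vecCons e fun i => w (r i)))
    (p : Fin (n + 1) → ℕ) (hp : StrictMono p) : 0 < z * rowDet (fun i => w (p i)) := by
  induction hN : p (Fin.last n) - p 0 using Nat.strong_induction_on generalizing p with
  | _ N ih =>
  subst hN
  by_cases hc : ∀ j : Fin n, p j.succ = p j.castSucc + 1
  · have : ∀ i, p i = p 0 + i := by
      intro i
      induction i using Fin.induction with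
      | zero => simp
      | succ i hi => rw [hc, hi]; simp; omega
    simpa only [← this] using hcons (p 0)
  · push Not at hc
    obtain ⟨j, hj⟩ := hc
    obtain ⟨d, rfl⟩ : ∃ d, n = d + 1 := ⟨n - 1, by have := j.isLt; omega⟩
    -- One row is inserted in a gap of `p`. Dropping the first or the last row of `x` then gives a
    -- smaller spread, so the induction applies to both.
    let x : Fin (d + 3) → ℕ := j.castSucc.succ.insertNth (p j.castSucc + 1) p
    have hlt := hp (Fin.castSucc_lt_succ (i := j))
    have hx : StrictMono x :=
      Fin.strictMono_insertNth hp j _ (Nat.lt_succ_self _) (by omega)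
    have hxp : ∀ k, x (j.castSucc.succ.succAbove k) = p k := fun k => by simp [x]
    have hx0 : x 0 = p 0 := by
      rw [← hxp]; congr 1
    have hxl : x (Fin.last _) = p (Fin.last _) := by
      rw [← hxp]; congr 1
      rw [Fin.succAbove_of_lt_succ _ _ (by simp [Fin.lt_def]; omega)]
      simp
    have hpl := rowDet_plucker e (fun k => w (x k)) j
    simp only [hxp] at hpl
    have hcast : StrictMono fun k : Fin (d + 2) => x k.castSucc :=
      hx.comp Fin.strictMono_castSucc
    have hsucc : StrictMono fun k : Fin (d + 2) => x k.succ :=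
      hx.comp (Fin.strictMono_succ)
    have A1 : 0 < z * rowDet (fun i => w (x i.castSucc)) := by
      refine ih _ ?_ _ hcast rfl
      rw [← hx0, ← hxl]
      have h1 : x (Fin.last (d + 1)).castSucc < x (Fin.last (d + 2)) :=
        hx (Fin.castSucc_lt_last _)
      have h2 : x 0 < x (Fin.last (d + 1)).castSucc := hx (by simp [Fin.lt_def])
      rw [Fin.castSucc_zero]
      omega
    have A2 : 0 < z * rowDet (fun i => w (x i.succ)) := by
      refine ih _ ?_ _ hsucc rfl
      rw [← hx0, ← hxl]
      have h1 := hx (Fin.succ_pos (0 : Fin (d + 2)))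
      have h2 : x (Fin.succ 0) < x (Fin.last (d + 1)).succ :=
        hx (by simp [Fin.lt_def])
      have h3 : (Fin.last (d + 1)).succ = Fin.last (d + 2) := rfl
      rw [h3] at h2 ⊢
      omega
    have B1 := h0 _ (hcast.comp j.succ.strictMono_succAbove)
    have hge : ∀ k : Fin (d + 2), 1 ≤ x k.succ := fun k => by
      have := hx (Fin.succ_pos k); omega
    -- Without the first row of `x` all indices are at least `1`, so `B2` and `B3` are strict; `B1`
    -- may use row `0` and is only weak.
    have B2 := h1 _ (hsucc.comp j.castSucc.strictMono_succAbove) (fun _ => hge _)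
    have B3 := h1 _ (hsucc.comp Fin.strictMono_castSucc) (fun _ => hge _)
    refine pos_of_mul_pos_left B3 ?_
    have := add_pos_of_nonneg_of_pos (mul_nonneg B1 A2.le) (mul_pos B2 A1)
    convert this using 1
    simp only [Function.comp_def]
    linear_combination (-(z * z')) * hpl

/-! ### The row at infinity. -/

section

open Filter Topology

/-- Sorting the rows changes the minor only by a sign, and a repeated row makes it zero. -/
theorem im_mul_rowDet_eq_zero {n : ℕ} {z : ℂ} {V : ℕ → Fin n → ℂ}
    (h : ∀ q : Fin n → ℕ, StrictMono q → 0 < z * rowDet (fun i => V (q i))) (q : Fin n → ℕ) :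
    (z * rowDet (fun i => V (q i))).im = 0 := by
  by_cases hinj : Function.Injective q
  · have h1 := h (q ∘ Tuple.sort q) ((Tuple.monotone_sort q).strictMono_of_injective
      (hinj.comp (Tuple.sort q).injective))
    have h2 := (rowDet (n := n)).map_perm (fun i => V (q i)) (Tuple.sort q)
    simp only [Function.comp_def] at h1 h2
    rw [h2] at h1
    rcases Int.units_eq_one_or (Equiv.Perm.sign (Tuple.sort q)) with hs | hs
    · rw [hs, one_smul] at h1
      exact (Complex.pos_iff.1 h1).2.symm
    · rw [hs, Units.neg_smul, one_smul, mul_neg] at h1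
      have := (Complex.pos_iff.1 h1).2
      rw [Complex.neg_im] at this
      linarith
  · rw [Function.Injective] at hinj
    push Not at hinj
    obtain ⟨i, j, hij, hne⟩ := hinj
    rw [AlternatingMap.map_eq_zero_of_eq _ _ (by rw [hij]) hne, mul_zero, Complex.zero_im]

/-- If the maximal minors of a sequence of rows lie on a common ray, then all the rows are real
combinations of the first ones. -/
theorem exists_real_coordinates {n : ℕ} {z : ℂ} {V : ℕ → Fin n → ℂ}
    (h : ∀ q : Fin n → ℕ, StrictMono q → 0 < z * rowDet (fun i => V (q i))) :
    ∃ x : ℕ → EuclideanSpace ℝ (Fin n), ∀ a, V a = ∑ j : Fin n, (x a j : ℂ) • V j := by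
  let B : Matrix (Fin n) (Fin n) ℂ := Matrix.of fun j : Fin n => V j
  have hB : 0 < z * B.det := h (fun j => j) Fin.val_strictMono
  have key : ∀ a, B.det • V a = ∑ j : Fin n, (B.updateRow j (V a)).det • V j := by
    intro a
    have := Matrix.mulVec_cramer B.transpose (V a)
    rw [Matrix.det_transpose] at this
    rw [← this]
    ext i
    simp [Matrix.mulVec, dotProduct, Matrix.cramer_transpose_apply, B, mul_comm]
  -- Cramer's rule: the coordinates are quotients of minors, and `z` times each of these is real.
  refine ⟨fun a => WithLp.toLp 2 fun j =>
    (z * (B.updateRow j (V a)).det).re / (z * B.det).re, fun a => ?_⟩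
  have hre : ∀ w : ℂ, w.im = 0 → ((w.re : ℝ) : ℂ) = w := fun w hw => Complex.ext rfl (by simp [hw])
  have h1 : ∀ j, (((z * (B.updateRow j (V a)).det).re : ℝ) : ℂ) = z * (B.updateRow j (V a)).det := by
    intro j
    refine hre _ ?_
    have := im_mul_rowDet_eq_zero h (Function.update (fun j : Fin n => (j : ℕ)) j a)
    convert this using 4
    congr 1
    ext i k
    by_cases hi : i = j
    · subst hi; simp
    · simp [hi, B]
  have h2 : (((z * B.det).re : ℝ) : ℂ) = z * B.det := hre _ (Complex.pos_iff.1 hB).2.symm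
  have hz : z ≠ 0 := left_ne_zero_of_mul hB.ne'
  have hd : B.det ≠ 0 := right_ne_zero_of_mul hB.ne'
  have := key a
  calc V a = B.det⁻¹ • B.det • V a := by rw [inv_smul_smul₀ hd]
    _ = _ := by
      rw [this, Finset.smul_sum]
      refine Finset.sum_congr rfl fun j _ => ?_
      rw [smul_smul]
      congr 1
      simp only [Complex.ofReal_div, h1, h2]
      field_simp

theorem rowDet_sum_smul {n : ℕ} (x : Fin n → Fin n → ℂ) (b : Fin n → Fin n → ℂ) :
    rowDet (fun i => ∑ j, x i j • b j) = rowDet x * rowDet b := by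
  have := Matrix.det_mul (Matrix.of x) (Matrix.of b)
  change _ = (Matrix.of x).det * (Matrix.of b).det
  rw [← this]
  change Matrix.det _ = _
  congr 1
  ext i k
  simp [Matrix.mul_apply]

/-- Variation diminution: a real linear form does not change sign infinitely often along rows all
of whose maximal minors are positive. -/
theorem not_frequently_pos_and_neg {n : ℕ} {x : ℕ → EuclideanSpace ℝ (Fin n)}
    (h : ∀ q : Fin n → ℕ, StrictMono q → 0 < rowDet (fun i j => (x (q i) j : ℂ)))
    (y : EuclideanSpace ℝ (Fin n)) (hpos : ∃ᶠ a in atTop, 0 < inner ℝ y (x a))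
    (hneg : ∃ᶠ a in atTop, inner ℝ y (x a) < 0) : False := by
  obtain ⟨φ, hφ, hs⟩ := extraction_forall_of_frequently
    -- Rows with alternating signs of the form make every term of the linear relation positive,
    -- although the sum is zero.
    (P := fun i a => 0 < (-1 : ℝ) ^ i * inner ℝ y (x a)) (by
      intro i
      rcases Nat.even_or_odd i with hi | hi
      · simpa [hi.neg_one_pow] using hpos
      · simpa [hi.neg_one_pow] using hneg)
  let l : (Fin n → ℂ) →ₗ[ℂ] ℂ := ∑ j, (y j : ℂ) • LinearMap.proj j
  have hl : ∀ a, l (fun j => (x a j : ℂ)) = ((inner ℝ y (x a) : ℝ) : ℂ) := by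
    intro a
    simp [l, PiLp.inner_apply, mul_comm]
  have h0 := sum_neg_one_pow_mul_rowDet (fun (i : Fin (n + 1)) j => (x (φ i) j : ℂ)) l
  refine absurd h0 (ne_of_gt ?_)
  refine Finset.sum_pos (fun i _ => mul_pos ?_ ?_) Finset.univ_nonempty
  · rw [hl]
    exact_mod_cast hs i
  · exact h _ (hφ.comp (Fin.val_strictMono.comp i.strictMono_succAbove))

/-- Compactness of the sphere gives limits `u` and `u'` of the directions and of their shifts along
one ultrafilter. If they differed, the form `inner ℝ (u - u')` would be positive at `u` and negative
at `u'`, hence change sign infinitely often along `x`. -/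
theorem exists_common_limit_direction {n : ℕ} {x : ℕ → EuclideanSpace ℝ (Fin n)} (hn : n ≠ 0)
    (h : ∀ q : Fin n → ℕ, StrictMono q → 0 < rowDet (fun i j => (x (q i) j : ℂ))) :
    (∀ a, x a ≠ 0) ∧ ∃ u : EuclideanSpace ℝ (Fin n), u ≠ 0 ∧
      Tendsto (fun a => ‖x a‖⁻¹ • x a) (hyperfilter ℕ) (𝓝 u) ∧
      Tendsto (fun a => ‖x (a + 1)‖⁻¹ • x (a + 1)) (hyperfilter ℕ) (𝓝 u) := by
  have hx : ∀ a, x a ≠ 0 := by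
    intro a ha
    have := h (fun i => a + i) (fun i j hij => by simpa using hij)
    obtain ⟨m, rfl⟩ := Nat.exists_eq_succ_of_ne_zero hn
    rw [AlternatingMap.map_coord_zero _ (0 : Fin (m + 1)) (by ext; simp [ha])] at this
    exact this.false
  have hsph : ∀ a, ‖x a‖⁻¹ • x a ∈ Metric.sphere (0 : EuclideanSpace ℝ (Fin n)) 1 := by
    intro a
    simp [norm_smul, norm_ne_zero_iff.2 (hx a)]
  have hlim : ∀ f : ℕ → ℕ, ∃ u ∈ Metric.sphere (0 : EuclideanSpace ℝ (Fin n)) 1,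
      Tendsto (fun a => ‖x (f a)‖⁻¹ • x (f a)) (hyperfilter ℕ) (𝓝 u) := by
    intro f
    exact (isCompact_sphere (0 : EuclideanSpace ℝ (Fin n)) 1).ultrafilter_le_nhds'
      ((hyperfilter ℕ).map fun a => ‖x (f a)‖⁻¹ • x (f a))
      (Ultrafilter.mem_map.2 (univ_mem' fun a => hsph _))
  obtain ⟨u, hu, hul⟩ := hlim id
  obtain ⟨u', hu', hul'⟩ := hlim (· + 1)
  have hle : (hyperfilter ℕ : Filter ℕ) ≤ atTop := Nat.hyperfilter_le_atTop
  rw [mem_sphere_zero_iff_norm] at hu hu'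
  have huu : u = u' := by
    by_contra hne
    have hlt : inner ℝ u u' < 1 := by
      refine lt_of_le_of_ne ?_ fun heq => hne ((inner_eq_one_iff_of_norm_eq_one hu hu').1 heq)
      have := real_inner_le_norm u u'
      rwa [hu, hu', one_mul] at this
    have h1 : 0 < inner ℝ (u - u') u := by
      rw [inner_sub_left, real_inner_self_eq_norm_sq, hu, real_inner_comm]; linarith
    have h2 : inner ℝ (u - u') u' < 0 := by
      rw [inner_sub_left, real_inner_self_eq_norm_sq, hu']; linarith
    have t1 := (tendsto_const_nhds (x := u - u')).inner (𝕜 := ℝ) hul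
    have t2 := (tendsto_const_nhds (x := u - u')).inner (𝕜 := ℝ) hul'
    refine not_frequently_pos_and_neg h (u - u') ?_ ?_
    · refine Frequently.filter_mono (Eventually.frequently ?_) hle
      filter_upwards [t1.eventually_const_lt h1] with a ha
      rw [inner_smul_right] at ha
      exact pos_of_mul_pos_right ha (by positivity)
    · refine (tendsto_add_atTop_nat 1).frequently
        (Frequently.filter_mono (Eventually.frequently ?_) hle)
      filter_upwards [t2.eventually_lt_const h2] with a ha
      rw [inner_smul_right] at ha
      exact neg_of_mul_neg_right ha (by positivity)
  subst huu
  exact ⟨hx, u, norm_ne_zero_iff.1 (by rw [hu]; exact one_ne_zero), hul, hul'⟩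

end

section

open Filter Topology

/-- Row `a` shifted by one place agrees with row `a + 1`, and both have the same limit direction, so
the limit is proportional to its own shift. The sign `(-1) ^ (d + 1)` moves the limit row from last
to first position. -/
theorem exists_limit_row {d : ℕ} {z : ℂ} {γ : ℕ → ℂ}
    (h : ∀ q : Fin (d + 2) → ℕ, StrictMono q → 0 < z * rowDet (fun i j => γ (q i + j))) :
    ∃ y : Fin (d + 2) → ℂ, y ≠ 0 ∧
      ((∃ r : ℝ, 0 ≤ r ∧ ∀ i : Fin (d + 1), y i.succ = r * y i.castSucc) ∨
        ∀ i : Fin (d + 1), y i.castSucc = 0) ∧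
      ∀ R : Fin (d + 1) → ℕ, StrictMono R →
        0 ≤ z * (-1) ^ (d + 1) * rowDet (Matrix.vecCons y fun i j => γ (R i + j)) := by
  let V : ℕ → Fin (d + 2) → ℂ := fun a j => γ (a + j)
  obtain ⟨x, hx⟩ := exists_real_coordinates (V := V) h
  let B : Fin (d + 2) → Fin (d + 2) → ℂ := fun j => V j
  have hB : 0 < z * rowDet B := h (fun j => j) Fin.val_strictMono
  have hxpos : ∀ q : Fin (d + 2) → ℕ, StrictMono q →
      0 < rowDet (fun i j => (x (q i) j : ℂ)) := by
    intro q hq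
    refine pos_of_mul_pos_left hB ?_
    have h1 := h q hq
    have h2 : (fun i (j : Fin (d + 2)) => γ (q i + j)) = fun i => ∑ j, (x (q i) j : ℂ) • B j := by
      funext i
      exact hx (q i)
    rw [h2, rowDet_sum_smul (fun i j => (x (q i) j : ℂ))] at h1
    convert h1 using 1
    ring
  obtain ⟨hx0, u, hu, hul, hul'⟩ := exists_common_limit_direction (by omega) hxpos
  let T : EuclideanSpace ℝ (Fin (d + 2)) → Fin (d + 2) → ℂ := fun v => ∑ j, (v j : ℂ) • B j
  have hT : Continuous T := by
    refine continuous_finsetSum _ fun j _ =>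
      Continuous.smul (f := fun v : EuclideanSpace ℝ (Fin (d + 2)) => (v j : ℂ)) ?_
        continuous_const
    exact Complex.continuous_ofReal.comp (by fun_prop)
  have hTx : ∀ a, T (‖x a‖⁻¹ • x a) = ((‖x a‖⁻¹ : ℝ) : ℂ) • V a := by
    intro a
    rw [hx a, Finset.smul_sum]
    refine Finset.sum_congr rfl fun j _ => ?_
    rw [smul_smul]
    simp
    rfl
  have hV : Tendsto (fun a => ((‖x a‖⁻¹ : ℝ) : ℂ) • V a) (hyperfilter ℕ) (𝓝 (T u)) := by
    simp only [← hTx]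
    exact (hT.tendsto u).comp hul
  have hV' : Tendsto (fun a => ((‖x (a + 1)‖⁻¹ : ℝ) : ℂ) • V (a + 1)) (hyperfilter ℕ)
      (𝓝 (T u)) := by
    simp only [← hTx]
    exact (hT.tendsto u).comp hul'
  have hpos : ∀ a, 0 < ‖x a‖ := fun a => norm_pos_iff.2 (hx0 a)
  refine ⟨T u, ?_, ?_, ?_⟩
  · intro hTu
    have hdet : (Matrix.of B).det ≠ 0 := right_ne_zero_of_mul hB.ne'
    have := Matrix.eq_zero_of_vecMul_eq_zero hdet (v := fun j => (u j : ℂ)) (by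
      rw [← hTu]
      ext k
      simp [Matrix.vecMul, dotProduct, T])
    apply hu
    ext j
    simpa using congrFun this j
  · by_cases hc : ∀ i : Fin (d + 1), T u i.castSucc = 0
    · exact Or.inr hc
    left
    push Not at hc
    obtain ⟨i, hi⟩ := hc
    have c1 : ∀ i, Tendsto (fun a => ((‖x a‖⁻¹ : ℝ) : ℂ) * V a i) (hyperfilter ℕ)
        (𝓝 (T u i)) := fun i => by
      simpa using (tendsto_pi_nhds.1 hV i)
    have c2 : ∀ i, Tendsto (fun a => ((‖x (a + 1)‖⁻¹ : ℝ) : ℂ) * V (a + 1) i) (hyperfilter ℕ)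
        (𝓝 (T u i)) := fun i => by
      simpa using (tendsto_pi_nhds.1 hV' i)
    have hVs : ∀ a (i : Fin (d + 1)), V a i.succ = V (a + 1) i.castSucc := by
      intro a i
      simp only [V, Fin.val_succ, Fin.val_castSucc]
      congr 1
      ring
    -- The ratio of normalising factors; it converges as soon as one entry `T u i.castSucc` is
    -- nonzero, and its limit is the ratio of the geometric row.
    let ρ : ℕ → ℝ := fun a => ‖x (a + 1)‖ / ‖x a‖
    have hρ : ∀ a (i : Fin (d + 1)), ((‖x a‖⁻¹ : ℝ) : ℂ) * V a i.succ =
        ρ a * (((‖x (a + 1)‖⁻¹ : ℝ) : ℂ) * V (a + 1) i.castSucc) := by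
      intro a i
      rw [hVs]
      have h1 : (‖x a‖ : ℂ) ≠ 0 := by exact_mod_cast (hpos a).ne'
      have h2 : (‖x (a + 1)‖ : ℂ) ≠ 0 := by exact_mod_cast (hpos (a + 1)).ne'
      simp only [ρ, Complex.ofReal_inv, Complex.ofReal_div]
      field_simp
    have hlim : Tendsto (fun a => (ρ a : ℂ)) (hyperfilter ℕ)
        (𝓝 (T u i.succ / T u i.castSucc)) := by
      refine ((c1 i.succ).div (c2 i.castSucc) hi).congr' ?_
      filter_upwards [(c2 i.castSucc).eventually_ne hi] with a ha
      rw [Pi.div_apply, hρ, mul_div_cancel_right₀ _ ha]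
    have hnn : (0 : ℂ) ≤ T u i.succ / T u i.castSucc := by
      refine ge_of_tendsto' hlim fun a => ?_
      exact_mod_cast div_nonneg (norm_nonneg (x (a + 1))) (norm_nonneg (x a))
    obtain ⟨r, hr⟩ : ∃ r : ℝ, (r : ℂ) = T u i.succ / T u i.castSucc :=
      ⟨_, Complex.ext rfl (Complex.nonneg_iff.1 hnn).2⟩
    rw [← hr] at hlim hnn
    refine ⟨r, by exact_mod_cast hnn, fun m => ?_⟩
    refine tendsto_nhds_unique (c1 m.succ) ?_
    simp only [hρ]
    exact hlim.mul (c2 m.castSucc)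
  · intro R hR
    have hcont : Continuous fun v : Fin (d + 2) → ℂ =>
        z * (-1) ^ (d + 1) * rowDet (Matrix.vecCons v fun i j => γ (R i + j)) := by
      refine continuous_const.mul ?_
      refine Continuous.matrix_det (A := fun v : Fin (d + 2) → ℂ =>
        Matrix.of (Matrix.vecCons v fun i (j : Fin (d + 2)) => γ (R i + j))) ?_
      refine continuous_pi fun i => ?_
      refine Fin.cases ?_ (fun i => ?_) i
      · exact continuous_id
      · exact continuous_const
    refine ge_of_tendsto ((hcont.tendsto (T u)).comp hV) ?_
    have hle : (hyperfilter ℕ : Filter ℕ) ≤ atTop := Nat.hyperfilter_le_atTop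
    filter_upwards [hle (eventually_gt_atTop (R (Fin.last d)))] with a ha
    have h1 := (rowDet (n := d + 2)).map_vecCons_smul (fun i j => γ (R i + j))
      ((‖x a‖⁻¹ : ℝ) : ℂ) (V a)
    simp only [Function.comp_apply]
    have hmono : StrictMono (Fin.insertNth (α := fun _ => ℕ) (Fin.last (d + 1)) a R) :=
      Fin.strictMono_insertNth_last hR a ha
    have h2 := h _ hmono
    have h3 := map_vecCons_removeNth rowDet (Fin.last (d + 1))
      (fun i j => γ ((Fin.insertNth (α := fun _ => ℕ) (Fin.last (d + 1)) a R) i + j))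
    simp only [Fin.insertNth_apply_same, Fin.insertNth_apply_succAbove] at h3
    rw [h1, smul_eq_mul]
    change _ ≤ z * (-1) ^ (d + 1) * (_ * rowDet (Matrix.vecCons (fun j => γ (a + j)) _))
    rw [h3, Fin.val_last]
    have e1 : ((-1 : ℂ) ^ (d + 1)) * (-1) ^ (d + 1) = 1 := by
      rw [← mul_pow]; simp
    have h4 : (0 : ℂ) ≤ ((‖x a‖⁻¹ : ℝ) : ℂ) := by
      exact_mod_cast (inv_nonneg.2 (norm_nonneg (x a)))
    refine (mul_nonneg h4 h2.le).trans_eq ?_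
    linear_combination (-((‖x a‖⁻¹ : ℝ) : ℂ) * z * rowDet (fun i j =>
      γ ((Fin.insertNth (α := fun _ => ℕ) (Fin.last (d + 1)) a R) i + j))) * e1

end

/-- Nonnegative minors with a nonzero vector `y` as first row are positive if the row number `0`
is not used. -/
theorem mul_rowDet_vecCons_pos {d : ℕ} {z z' : ℂ} {w : ℕ → Fin (d + 2) → ℂ}
    (h : ∀ q : Fin (d + 2) → ℕ, StrictMono q → 0 < z * rowDet (fun i => w (q i)))
    {y : Fin (d + 2) → ℂ} (hy : y ≠ 0) (hz : z' ≠ 0)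
    (h0 : ∀ R : Fin (d + 1) → ℕ, StrictMono R →
      0 ≤ z' * rowDet (Matrix.vecCons y fun i => w (R i)))
    (R : Fin (d + 1) → ℕ) (hR : StrictMono R) (hR1 : ∀ i, 1 ≤ R i) :
    0 < z' * rowDet (Matrix.vecCons y fun i => w (R i)) := by
  refine lt_of_le_of_ne (h0 R hR) fun heq => hy ?_
  have hyR : rowDet (Matrix.vecCons y fun i => w (R i)) = 0 :=
    (mul_eq_zero.1 heq.symm).resolve_left hz
  let R0 : Fin (d + 2) → ℕ := Fin.cons 0 R
  have hR0 : StrictMono R0 := Fin.strictMono_cons.2 ⟨fun j => hR1 j, hR⟩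
  -- With row `0` before `R` and one row after it, the vanishing minor is the right side of the
  -- Plücker relation, so both nonnegative terms on the left vanish.
  let x : Fin (d + 3) → ℕ := (Fin.last (d + 2)).insertNth (R (Fin.last d) + 1) R0
  have hx : StrictMono x := Fin.strictMono_insertNth_last hR0 _ (Nat.lt_succ_self (R _))
  have hxc : ∀ k : Fin (d + 2), x k.castSucc = R0 k := fun k => by
    rw [← Fin.succAbove_last]; exact Fin.insertNth_apply_succAbove _ _ _ k
  have hR0pos : 0 < z * rowDet (fun i => w (R0 i)) := h R0 hR0
  have hzero : ∀ j : Fin (d + 1),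
      rowDet (Matrix.vecCons y fun k => w (R0 (j.succ.succAbove k))) = 0 := by
    intro j
    have hpl := rowDet_plucker y (fun k => w (x k)) j
    have e1 : (fun k : Fin (d + 1) => w (x k.castSucc.succ)) = fun k => w (R k) := by
      funext k
      rw [← Fin.castSucc_succ, hxc]
      rfl
    rw [e1, hyR, zero_mul] at hpl
    simp only [hxc] at hpl
    have hcast : StrictMono fun k : Fin (d + 2) => x k.succ := hx.comp Fin.strictMono_succ
    have A1 := h0 _ (hR0.comp j.succ.strictMono_succAbove)
    have A2 := h _ hcast
    have A3 := h0 _ (hcast.comp j.castSucc.strictMono_succAbove)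
    have hsum : z' * rowDet (Matrix.vecCons y fun k => w (R0 (j.succ.succAbove k))) *
        (z * rowDet (fun k => w (x k.succ))) +
        z' * rowDet (Matrix.vecCons y fun k => w (x (j.castSucc.succAbove k).succ)) *
        (z * rowDet (fun i => w (R0 i))) = 0 := by
      linear_combination z * z' * hpl
    have := ((add_eq_zero_iff_of_nonneg (mul_nonneg A1 A2.le) (mul_nonneg A3 hR0pos.le)).1
      hsum).1
    exact (mul_eq_zero.1 ((mul_eq_zero.1 this).resolve_right A2.ne')).resolve_left hz
  -- All Cramer coordinates of `y` in the basis `w (R0 k)` are zero.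
  have hl : ∀ l : (Fin (d + 2) → ℂ) →ₗ[ℂ] ℂ, l y = 0 := by
    intro l
    have key := sum_neg_one_pow_mul_rowDet (Matrix.vecCons y fun k => w (R0 k)) l
    rw [Fin.sum_univ_succ, Finset.sum_eq_zero, add_zero] at key
    · have : rowDet (fun i => w (R0 i)) ≠ 0 := right_ne_zero_of_mul hR0pos.ne'
      simp only [Fin.zero_succAbove, Matrix.cons_val_succ, Fin.val_zero, pow_zero, one_mul,
        Matrix.cons_val_zero] at key
      exact (mul_eq_zero.1 key).resolve_right this
    · intro i _
      have hz : rowDet (fun j => Matrix.vecCons y (fun k => w (R0 k)) (i.succ.succAbove j)) =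
          0 := by
        have : (fun j => Matrix.vecCons y (fun k => w (R0 k)) (i.succ.succAbove j)) =
            Matrix.vecCons y fun k => w (R0 (i.succAbove k)) := by
          funext j
          refine Fin.cases ?_ (fun j => ?_) j <;> simp
        rw [this]
        refine Fin.cases ?_ (fun j => ?_) i
        · exact hyR
        · exact hzero j
      rw [hz, mul_zero]
  ext i
  exact hl (LinearMap.proj i)

/-! ### Hankel minors and elimination of the limit row. -/

/-- The minor of the infinite Hankel matrix of `γ` with rows `p` and columns `q`. -/
noncomputable def hankelMinor {n : ℕ} (γ : ℕ → ℂ) (p q : Fin n → ℕ) : ℂ :=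
  rowDet fun i j => γ (p i + q j)

theorem hankelMinor_comm {n : ℕ} (γ : ℕ → ℂ) (p q : Fin n → ℕ) :
    hankelMinor γ p q = hankelMinor γ q p := by
  have := Matrix.det_transpose (Matrix.of fun i j => γ (p i + q j))
  unfold hankelMinor
  change Matrix.det (Matrix.of fun i j => γ (p i + q j)) = _
  rw [← this]
  change _ = Matrix.det _
  congr 1
  ext i j
  simp [add_comm]

theorem rowDet_vecCons_of_castSucc_eq_zero {k : ℕ} (y : Fin (k + 1) → ℂ)
    (hy : ∀ i : Fin k, y i.castSucc = 0) (w : Fin k → Fin (k + 1) → ℂ) :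
    rowDet (Matrix.vecCons y w) =
      (-1) ^ k * y (Fin.last k) * rowDet (fun i j => w i j.castSucc) := by
  change Matrix.det (Matrix.of (Matrix.vecCons y w)) = _
  rw [Matrix.det_succ_row_zero, Fin.sum_univ_castSucc, Finset.sum_eq_zero, zero_add]
  · simp only [Fin.val_last, Matrix.of_apply, Matrix.cons_val_zero, Fin.succAbove_last]
    rfl
  · intro i _
    simp [hy]

/-- Subtracting `c j` times each column from the next leaves only the first entry of the row `y`. -/
theorem rowDet_vecCons_of_succ_eq_mul {k : ℕ} (y : Fin (k + 1) → ℂ) (c : Fin k → ℂ)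
    (hy : ∀ i : Fin k, y i.succ = c i * y i.castSucc) (w : Fin k → Fin (k + 1) → ℂ) :
    rowDet (Matrix.vecCons y w) =
      y 0 * rowDet (fun i j => w i j.succ - c j * w i j.castSucc) := by
  let A : Matrix (Fin (k + 1)) (Fin (k + 1)) ℂ := Matrix.of (Matrix.vecCons y w)
  let B : Matrix (Fin (k + 1)) (Fin (k + 1)) ℂ := Matrix.of fun i =>
    Fin.cons (A i 0) fun j => A i j.succ - c j * A i j.castSucc
  have hAB : A.det = B.det := Matrix.det_eq_of_forall_col_eq_smul_add_pred c
    (fun i => by simp [B]) (fun i j => by simp [B])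
  change A.det = _
  rw [hAB, Matrix.det_succ_row_zero, Fin.sum_univ_succ, Finset.sum_eq_zero, add_zero]
  · simp only [B, A, Fin.val_zero, pow_zero, one_mul, Matrix.of_apply, Fin.cons_zero,
      Matrix.cons_val_zero]
    rfl
  · intro i _
    simp [B, A, hy]

/-! ### The strict case: from one order to the next. -/

section

theorem sub_pow_mul_eq_sum_Ico (γ : ℕ → ℂ) (r : ℂ) (m : ℕ) {a b : ℕ} (hab : a ≤ b) :
    γ (m + b) - r ^ (b - a) * γ (m + a) =
      ∑ s ∈ Finset.Ico a b, r ^ (b - 1 - s) * (γ (m + s + 1) - r * γ (m + s)) := by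
  induction b, hab using Nat.le_induction with
  | base => simp
  | succ b hab ih =>
    rw [Finset.sum_Ico_succ_top hab]
    have : ∑ s ∈ Finset.Ico a b, r ^ (b + 1 - 1 - s) * (γ (m + s + 1) - r * γ (m + s)) =
        r * ∑ s ∈ Finset.Ico a b, r ^ (b - 1 - s) * (γ (m + s + 1) - r * γ (m + s)) := by
      rw [Finset.mul_sum]
      refine Finset.sum_congr rfl fun s hs => ?_
      rw [Finset.mem_Ico] at hs
      rw [show b + 1 - 1 - s = (b - 1 - s) + 1 by omega, pow_succ]
      ring
    rw [this, ← ih, show b + 1 - a = (b - a) + 1 by omega, pow_succ]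
    simp only [Nat.add_sub_cancel, Nat.sub_self, pow_zero, ← add_assoc]
    ring

theorem hankelMinor_consecutive {n : ℕ} (γ : ℕ → ℂ) (a : ℕ) (q : Fin n → ℕ) :
    hankelMinor γ (fun i => a + i) q = hankelMinor γ (fun i => q i + a) (fun i => i) := by
  rw [hankelMinor_comm]
  unfold hankelMinor
  congr 1
  ext i j
  congr 1
  ring

theorem hankelMinor_pos_of_one_le {k : ℕ} {δ : ℕ → ℂ} {z : ℂ}
    (hS : ∀ p q : Fin k → ℕ, StrictMono p → StrictMono q →
      0 < z * hankelMinor (fun a => δ (a + 1)) p q)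
    {p q : Fin k → ℕ} (hp : StrictMono p) (hq : StrictMono q) (h1 : ∀ i, 1 ≤ p i) :
    0 < z * hankelMinor δ p q := by
  have := hS (fun i => p i - 1) q (fun i j hij => by
    have := hp hij; have := h1 i; dsimp only; omega) hq
  convert this using 2
  unfold hankelMinor
  congr 1
  ext i j
  have := h1 i
  exact congrArg δ (by dsimp only; omega)

variable {d : ℕ}

/-- From the case `k` to the case `k + 1`: for every choice of the columns there is a limiting
row, whose minors are controlled by the case `k`. -/
theorem exists_limit_row_of_columns
    (hstrict : ∀ (γ : ℕ → ℂ) (z : ℂ),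
      (∀ q : Fin (d + 1) → ℕ, StrictMono q → 0 < z * hankelMinor γ q (fun i => i)) →
      ∀ p q : Fin (d + 1) → ℕ, StrictMono p → StrictMono q → 0 < z * hankelMinor γ p q)
    (hweak : ∀ (γ : ℕ → ℂ) (z : ℂ),
      (∀ q : Fin (d + 1) → ℕ, StrictMono q → 0 ≤ z * hankelMinor γ q (fun i => i)) →
      ∀ p q : Fin (d + 1) → ℕ, StrictMono p → StrictMono q → 0 ≤ z * hankelMinor γ p q)
    {γ : ℕ → ℂ} {z : ℂ}
    (h : ∀ q : Fin (d + 2) → ℕ, StrictMono q → 0 < z * hankelMinor γ q (fun i => i))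
    {q : Fin (d + 2) → ℕ} (hq : StrictMono q) :
    ∃ (e : Fin (d + 2) → ℂ) (z' : ℂ),
      (∀ r : Fin (d + 1) → ℕ, StrictMono r →
        0 ≤ z' * rowDet (Matrix.vecCons e fun i j => γ (r i + q j))) ∧
      (∀ r : Fin (d + 1) → ℕ, StrictMono r → (∀ i, 1 ≤ r i) →
        0 < z' * rowDet (Matrix.vecCons e fun i j => γ (r i + q j))) := by
  obtain ⟨y, hy, hcase, hy0⟩ := exists_limit_row (z := z) (γ := γ) h
  have hz : z ≠ 0 := left_ne_zero_of_mul (h (fun i => i) Fin.val_strictMono).ne'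
  have hz' : z * (-1) ^ (d + 1) ≠ 0 := mul_ne_zero hz (pow_ne_zero _ (by norm_num))
  have hy1 := mul_rowDet_vecCons_pos (w := fun a (j : Fin (d + 2)) => γ (a + j)) h hy hz' hy0
  have shift : ∀ {R : Fin (d + 1) → ℕ}, StrictMono R → StrictMono fun i => R i + 1 :=
    fun hR i j hij => Nat.succ_lt_succ (hR hij)
  rcases hcase with ⟨ρ, hρ, hgeo⟩ | hlast
  · let δ : ℕ → ℂ := fun a => γ (a + 1) - ρ * γ a
    have hexp : ∀ R : Fin (d + 1) → ℕ,
        rowDet (Matrix.vecCons y fun i j => γ (R i + j)) =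
          y 0 * hankelMinor δ R (fun i => i) := by
      intro R
      rw [rowDet_vecCons_of_succ_eq_mul y (fun _ => (ρ : ℂ)) hgeo]
      rfl
    let z₁ := z * (-1) ^ (d + 1) * y 0
    have hw := hweak δ z₁ fun R hR => by
      have := hy0 R hR
      rwa [hexp, ← mul_assoc] at this
    -- Minors with the limit row are known to be strictly positive only for row indices at least
    -- `1`, so the strict case is applied to the shifted sequence.
    have hs := hstrict (fun a => δ (a + 1)) z₁ fun R hR => by
      have := hy1 _ (shift hR) (fun i => by omega)
      rw [hexp, ← mul_assoc] at this
      convert this using 2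
      unfold hankelMinor
      congr 1
      ext i j
      exact congrArg δ (by ring)
    let c : Fin (d + 1) → ℂ := fun j => (ρ : ℂ) ^ (q j.succ - q j.castSucc)
    -- The geometric row extended to the columns `q`. Eliminating it leaves, by telescoping, columns
    -- that are nonnegative combinations of columns of the Hankel matrix of `δ` over consecutive
    -- intervals.
    refine ⟨fun j => y 0 * (ρ : ℂ) ^ (q j - q 0), z * (-1) ^ (d + 1), ?_⟩
    have hqle : ∀ j : Fin (d + 1), q j.castSucc < q j.succ := fun j => hq Fin.castSucc_lt_succ
    have hexp' : ∀ R : Fin (d + 1) → ℕ,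
        z * (-1) ^ (d + 1) * rowDet (Matrix.vecCons (fun j => y 0 * (ρ : ℂ) ^ (q j - q 0))
          fun i j => γ (R i + q j)) =
        z₁ * rowDet (fun j => ∑ s ∈ Finset.Ico (q j.castSucc) (q j.succ),
          ((ρ ^ (q j.succ - 1 - s) : ℝ) : ℂ) • fun i => δ (R i + s)) := by
      intro R
      rw [rowDet_vecCons_of_succ_eq_mul _ c]
      · have := Matrix.det_transpose (Matrix.of fun (i j : Fin (d + 1)) =>
          γ (R i + q j.succ) - c j * γ (R i + q j.castSucc))
        simp only [Nat.sub_self, pow_zero, mul_one]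
        rw [← mul_assoc]
        change _ * Matrix.det (Matrix.of fun (i j : Fin (d + 1)) =>
          γ (R i + q j.succ) - c j * γ (R i + q j.castSucc)) = _ * Matrix.det _
        rw [← this]
        congr 2
        ext j i
        simp only [Matrix.transpose_apply, Matrix.of_apply, c]
        rw [sub_pow_mul_eq_sum_Ico γ ρ (R i) (hqle j).le]
        simp [δ]
      · intro i
        simp only [c]
        have h1 := hqle i
        have h2 : q 0 ≤ q i.castSucc := hq.monotone (Fin.zero_le _)
        rw [show q i.succ - q 0 = (q i.succ - q i.castSucc) + (q i.castSucc - q 0) by omega,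
          pow_add]
        ring
    have hwR : ∀ (R r : Fin (d + 1) → ℕ),
        rowDet (fun (i : Fin (d + 1)) j => δ (R j + r i)) = hankelMinor δ R r := by
      intro R r
      rw [hankelMinor_comm]
      unfold hankelMinor
      simp only [add_comm]
    have hG := fun (R : Fin (d + 1) → ℕ) (hR : StrictMono R) =>
      mul_rowDet_sum_smul z₁ (fun s i => δ (R i + s))
        (fun r hr => by rw [hwR]; exact hw R r hR hr)
        (fun j => Finset.Ico (q j.castSucc) (q j.succ))
        (fun i j hij s hs t ht => by
          rw [Finset.mem_Ico] at hs ht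
          have : q i.succ ≤ q j.castSucc := hq.monotone (by
            rw [Fin.le_def]; simpa using hij)
          omega)
        (fun j s => ρ ^ (q j.succ - 1 - s)) (fun _ _ _ => pow_nonneg hρ _)
    refine ⟨fun R hR => ?_, fun R hR hR1 => ?_⟩
    · rw [hexp']
      exact (hG R hR).1
    · rw [hexp']
      have hmono : StrictMono fun j : Fin (d + 1) => q j.succ - 1 := fun i j hij => by
        have h1 := hqle i
        have h2 : q i.succ < q j.succ := hq (Fin.succ_lt_succ_iff.2 hij)
        dsimp only
        omega
      -- The last index of each interval has weight `ρ ^ 0 = 1`, which is positive even for `ρ = 0`.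
      refine (hG R hR).2 (fun j => q j.succ - 1) hmono (fun j => ?_) (fun j => ?_) ?_
      · have := hqle j
        rw [Finset.mem_Ico]
        omega
      · simp
      · rw [hwR]
        exact hankelMinor_pos_of_one_le hs hR hmono hR1
  · have hexp : ∀ q R : Fin (d + 1) → ℕ, ∀ q' : Fin (d + 2) → ℕ, (∀ j, q' j.castSucc = q j) →
        rowDet (Matrix.vecCons y fun i j => γ (R i + q' j)) =
          (-1) ^ (d + 1) * y (Fin.last _) * hankelMinor γ R q := by
      intro q R q' hqq
      rw [rowDet_vecCons_of_castSucc_eq_zero y hlast]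
      simp only [hqq]
      rfl
    let z₁ := z * (-1) ^ (d + 1) * ((-1) ^ (d + 1) * y (Fin.last _))
    have hw := hweak γ z₁ fun R hR => by
      have := hy0 R hR
      rwa [hexp (fun i => i) R _ (fun _ => rfl), ← mul_assoc] at this
    have hs := hstrict (fun a => γ (a + 1)) z₁ fun R hR => by
      have := hy1 _ (shift hR) (fun i => by omega)
      rw [hexp (fun i => i) _ _ (fun _ => rfl), ← mul_assoc] at this
      convert this using 2
      unfold hankelMinor
      congr 1
      ext i j
      exact congrArg γ (by ring)
    have hqc : StrictMono fun j : Fin (d + 1) => q j.castSucc := hq.comp Fin.strictMono_castSucc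
    refine ⟨y, z * (-1) ^ (d + 1), fun R hR => ?_, fun R hR hR1 => ?_⟩
    · rw [hexp (fun j => q j.castSucc) R q (fun _ => rfl), ← mul_assoc]
      exact hw R _ hR hqc
    · rw [hexp (fun j => q j.castSucc) R q (fun _ => rfl), ← mul_assoc]
      exact hankelMinor_pos_of_one_le hs hR hqc hR1

theorem hankelMinor_pos_succ
    (hstrict : ∀ (γ : ℕ → ℂ) (z : ℂ),
      (∀ q : Fin (d + 1) → ℕ, StrictMono q → 0 < z * hankelMinor γ q (fun i => i)) →
      ∀ p q : Fin (d + 1) → ℕ, StrictMono p → StrictMono q → 0 < z * hankelMinor γ p q)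
    (hweak : ∀ (γ : ℕ → ℂ) (z : ℂ),
      (∀ q : Fin (d + 1) → ℕ, StrictMono q → 0 ≤ z * hankelMinor γ q (fun i => i)) →
      ∀ p q : Fin (d + 1) → ℕ, StrictMono p → StrictMono q → 0 ≤ z * hankelMinor γ p q)
    {γ : ℕ → ℂ} {z : ℂ}
    (h : ∀ q : Fin (d + 2) → ℕ, StrictMono q → 0 < z * hankelMinor γ q (fun i => i))
    {p q : Fin (d + 2) → ℕ} (hp : StrictMono p) (hq : StrictMono q) :
    0 < z * hankelMinor γ p q := by
  obtain ⟨e, z', h0, h1⟩ := exists_limit_row_of_columns hstrict hweak h hq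
  refine mul_rowDet_pos_of_consecutive z (fun a j => γ (a + q j)) (fun a => ?_) e z' h0 h1 p hp
  change 0 < z * hankelMinor γ (fun i => a + i) q
  rw [hankelMinor_consecutive]
  exact h _ fun i j hij => Nat.add_lt_add_right (hq hij) a

end

/-! ### The degenerate case. -/

/-- If the minors with the first `k` columns vanish, the infinite Hankel matrix has rank less than
`k`. -/
theorem hankelMinor_eq_zero {k : ℕ} {γ : ℕ → ℂ}
    (h : ∀ q : Fin k → ℕ, StrictMono q → hankelMinor γ q (fun i => i) = 0) (p q : Fin k → ℕ) :
    hankelMinor γ p q = 0 := by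
  let V : ℕ → Fin k → ℂ := fun a i => γ (a + i)
  -- If the rows spanned, `k` independent ones, sorted, would give a nonzero minor.
  have hspan : Submodule.span ℂ (Set.range V) ≠ ⊤ := by
    intro htop
    obtain ⟨κ, a, ha, hsp, hli⟩ := exists_linearIndependent' ℂ V
    rw [htop] at hsp
    let b := Module.Basis.mk hli hsp.ge
    have : Finite κ := Module.Finite.finite_basis b
    have := Fintype.ofFinite κ
    have hcard : Fintype.card κ = k := by
      rw [← Module.finrank_eq_card_basis b]
      simp
    let s : Finset ℕ := Finset.univ.map ⟨a, ha⟩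
    have hs : s.card = k := by simp [s, hcard]
    let r := s.orderEmbOfFin hs
    have hr : ∀ j, ∃ i, a i = r j := fun j => by
      have := s.orderEmbOfFin_mem hs j
      obtain ⟨i, _, hi⟩ := Finset.mem_map.1 this
      exact ⟨i, hi⟩
    choose σ hσ using hr
    have hinj : Function.Injective σ := fun i j hij => r.injective (by rw [← hσ, ← hσ, hij])
    have hli' := hli.comp σ hinj
    have hrows : LinearIndependent ℂ (Matrix.of fun i (j : Fin k) => γ (r i + j)).row := by
      have : (Matrix.of fun i (j : Fin k) => γ (r i + j)).row = (V ∘ a) ∘ σ := by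
        ext i j
        simp [V, hσ, Matrix.row]
      rw [this]
      exact hli'
    rw [Matrix.linearIndependent_rows_iff_isUnit, Matrix.isUnit_iff_isUnit_det] at hrows
    exact hrows.ne_zero (h r r.strictMono)
  obtain ⟨f, hf, hker⟩ := Submodule.exists_le_ker_of_lt_top _ hspan.lt_top
  let c : Fin k → ℂ := fun i => f (Pi.single i 1)
  have hfc : ∀ v : Fin k → ℂ, f v = ∑ i, c i * v i := by
    intro v
    conv_lhs => rw [← LinearMap.sum_single_apply (φ := fun _ => ℂ) v]
    rw [map_sum]
    refine Finset.sum_congr rfl fun j _ => ?_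
    rw [mul_comm, ← smul_eq_mul, ← map_smul, ← Pi.single_smul, smul_eq_mul, mul_one]
  have hrec : ∀ a, ∑ i : Fin k, c i * γ (a + i) = 0 := fun a => by
    rw [← hfc (V a)]
    exact hker (Submodule.subset_span ⟨a, rfl⟩)
  have hne : ∃ i, c i ≠ 0 := by
    by_contra hall
    push Not at hall
    apply hf
    ext v
    simp [hall, c]
  -- A form vanishing on all rows is a linear recurrence. Its top index `d < k` is its order, so
  -- every column lies in the span of the first `d`.
  obtain ⟨d, hd, hmax⟩ : ∃ d, c d ≠ 0 ∧ ∀ i, d < i → c i = 0 := by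
    classical
    have hN : (Finset.univ.filter fun i => c i ≠ 0).Nonempty := by
      obtain ⟨i, hi⟩ := hne
      exact ⟨i, by simp [hi]⟩
    refine ⟨Finset.max' _ hN, by simpa using Finset.max'_mem _ hN, fun i hi => ?_⟩
    by_contra hci
    exact absurd (Finset.le_max' _ i (by simp [hci])) (not_le.2 hi)
  let ρ : ℕ → ℕ → ℂ := fun m a => γ (a + m)
  let S : Submodule ℂ (ℕ → ℂ) := Submodule.span ℂ (Set.range fun i : Fin d => ρ i)
  have hmem : ∀ m, ρ m ∈ S := by
    intro m
    induction m using Nat.strong_induction_on with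
    | _ m ih =>
    by_cases hm : m < d
    · exact Submodule.subset_span ⟨⟨m, hm⟩, rfl⟩
    · push Not at hm
      have : ρ m = ∑ i ∈ Finset.univ.filter (· < d), (-(c d)⁻¹ * c i) • ρ (m - d + i) := by
        funext a
        have h1 := hrec (a + (m - d))
        have h2 : ∑ i : Fin k, c i * γ (a + (m - d) + i) =
            c d * γ (a + (m - d) + d) +
              ∑ i ∈ Finset.univ.filter (· < d), c i * γ (a + (m - d) + i) := by
          classical
          rw [← Finset.sum_filter_add_sum_filter_not Finset.univ (· < d), add_comm]
          congr 1
          refine Finset.sum_eq_single_of_mem d (by simp) fun i hi hid => ?_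
          simp only [Finset.mem_filter, not_lt] at hi
          rw [hmax i (lt_of_le_of_ne hi.2 (Ne.symm hid)), zero_mul]
        rw [h2] at h1
        have h3 : (∑ i ∈ Finset.univ.filter (· < d), (-(c d)⁻¹ * c i) • ρ (m - d + i)) a =
            -(c d)⁻¹ * ∑ i ∈ Finset.univ.filter (· < d), c i * γ (a + (m - d) + i) := by
          simp only [Finset.sum_apply, Pi.smul_apply, smul_eq_mul, Finset.mul_sum, ρ, mul_assoc,
            add_assoc]
        rw [h3, eq_neg_of_add_eq_zero_right h1]
        have h4 : a + (m - d) + d = a + m := by omega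
        rw [h4]
        field_simp
        rfl
      rw [this]
      refine Submodule.sum_mem _ fun i hi => Submodule.smul_mem _ _ (ih _ ?_)
      have : (i : ℕ) < d := by simpa using hi
      omega
  have hnli : ¬ LinearIndependent ℂ fun j => ρ (q j) := by
    intro hli
    have h1 := finrank_span_eq_card hli
    have h2 : Submodule.span ℂ (Set.range fun j => ρ (q j)) ≤ S := by
      rw [Submodule.span_le]
      rintro _ ⟨j, rfl⟩
      exact hmem _
    have : Module.Finite ℂ S := Module.Finite.span_of_finite ℂ (Set.finite_range _)
    have h3 := Submodule.finrank_mono h2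
    have h4 : Module.finrank ℂ S ≤ _ := finrank_range_le_card fun i : Fin d => ρ i
    rw [h1] at h3
    simp only [Fintype.card_fin] at h3 h4
    have := d.isLt
    omega
  rw [Fintype.not_linearIndependent_iff] at hnli
  obtain ⟨g, hg, j, hj⟩ := hnli
  change Matrix.det (Matrix.of fun i j => γ (p i + q j)) = 0
  rw [← Matrix.exists_mulVec_eq_zero_iff]
  refine ⟨g, fun h0 => hj (congrFun h0 j), ?_⟩
  ext i
  have := congrFun hg (p i)
  simpa [Matrix.mulVec, dotProduct, ρ, mul_comm] using this

/-! ### The weak case: perturbation by bidiagonal factors. -/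

/-- Each factor lets a row index stay or rise by one with positive weight. All terms are
nonnegative, so one path from `q` to `u` in `T` steps suffices for positivity. -/
theorem mul_rowDet_of_upper_bidiagonal {k : ℕ} {z : ℂ} {ε : ℝ} (hε : 0 < ε)
    (W : ℕ → ℕ → Fin k → ℂ) (hW : ∀ t a, W (t + 1) a = W t a + (ε : ℂ) • W t (a + 1))
    (h0 : ∀ r : Fin k → ℕ, StrictMono r → 0 ≤ z * rowDet (fun i => W 0 (r i))) (T : ℕ) :
    (∀ r : Fin k → ℕ, StrictMono r → 0 ≤ z * rowDet (fun i => W T (r i))) ∧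
    ∀ q u : Fin k → ℕ, StrictMono q → StrictMono u → (∀ i, q i ≤ u i) → (∀ i, u i ≤ q i + T) →
      0 < z * rowDet (fun i => W 0 (u i)) → 0 < z * rowDet (fun i => W T (q i)) := by
  induction T with
  | zero =>
    refine ⟨h0, fun q u _ _ h1 h2 hu => ?_⟩
    have : q = u := funext fun i => le_antisymm (h1 i) (h2 i)
    rwa [this]
  | succ T ih =>
    have hrow : ∀ q : Fin k → ℕ, (fun i => W (T + 1) (q i)) = fun i =>
        ∑ s ∈ ({q i, q i + 1} : Finset ℕ), ((if s = q i then (1 : ℝ) else ε : ℝ) : ℂ) • W T s := by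
      intro q
      funext i
      rw [Finset.sum_pair (by simp), hW]
      simp
    have hG := fun (q : Fin k → ℕ) (hq : StrictMono q) => mul_rowDet_sum_smul z (W T) ih.1
      (fun i => {q i, q i + 1})
      (fun i j hij s hs t ht => by
        have := hq hij
        simp only [Finset.mem_insert, Finset.mem_singleton] at hs ht
        omega)
      (fun i s => if s = q i then 1 else ε)
      (fun i s _ => by split_ifs; exacts [zero_le_one, hε.le])
    refine ⟨fun q hq => ?_, fun q u hq hu h1 h2 hpos => ?_⟩
    · rw [hrow]
      exact (hG q hq).1
    · rw [hrow]
      -- Every index still below its target advances by one.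
      have hmono : StrictMono fun i => min (u i) (q i + 1) := fun i j hij => by
        have := hq hij
        have := hu hij
        dsimp only
        omega
      refine (hG q hq).2 (fun i => min (u i) (q i + 1)) hmono (fun i => ?_) (fun i => ?_)
        (ih.2 _ u hmono hu (fun i => min_le_left _ _) (fun i => ?_) hpos)
      · have := h1 i
        simp only [Finset.mem_insert, Finset.mem_singleton]
        omega
      · split_ifs
        exacts [zero_lt_one, hε]
      · have := h2 i
        omega

theorem val_le_of_strictMono {k : ℕ} {u : Fin k → ℕ} (hu : StrictMono u) (i : Fin k) :
    (i : ℕ) ≤ u i := by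
  obtain ⟨i, hi⟩ := i
  induction i with
  | zero => exact Nat.zero_le _
  | succ i ih =>
    have h1 := ih (by omega)
    have h2 : u ⟨i, by omega⟩ < u ⟨i + 1, hi⟩ := hu (by simp)
    simp only at h1 ⊢
    omega

/-- Here the indices descend towards `0, ..., k - 1`, whose minor is positive. The cut-off `t < a`
is the one obeyed by the rows of `X ^ (a - t) * (X + ε) ^ min a t`, where a row is finished once `t`
reaches `a`. -/
theorem mul_rowDet_of_lower_bidiagonal {k : ℕ} {z : ℂ} {ε : ℝ} (hε : 0 < ε)
    (W : ℕ → ℕ → Fin k → ℂ)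
    (hW : ∀ t a, W (t + 1) a = W t a + ((if t < a then ε else 0 : ℝ) : ℂ) • W t (a - 1))
    (h0 : ∀ r : Fin k → ℕ, StrictMono r → 0 ≤ z * rowDet (fun i => W 0 (r i)))
    (hpos : 0 < z * rowDet (fun i : Fin k => W 0 i)) (T : ℕ) :
    (∀ r : Fin k → ℕ, StrictMono r → 0 ≤ z * rowDet (fun i => W T (r i))) ∧
    ∀ q : Fin k → ℕ, StrictMono q → (∀ i, q i ≤ i + T) →
      0 < z * rowDet (fun i => W T (q i)) := by
  induction T with
  | zero =>
    refine ⟨h0, fun q hq h1 => ?_⟩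
    have : q = fun i : Fin k => (i : ℕ) := funext fun i => le_antisymm (h1 i) (val_le_of_strictMono hq i)
    rwa [this]
  | succ T ih =>
    have hrow : ∀ q : Fin k → ℕ, (fun i => W (T + 1) (q i)) = fun i =>
        ∑ s ∈ ({q i - 1, q i} : Finset ℕ),
          ((if s = q i then (1 : ℝ) else if T < q i then ε else 0 : ℝ) : ℂ) • W T s := by
      intro q
      funext i
      rw [hW]
      rcases Nat.eq_zero_or_pos (q i) with hq | hq
      · simp [hq]
      · rw [Finset.sum_pair (by omega), add_comm]
        congr 1
        · rw [if_neg (show ¬ q i - 1 = q i by omega)]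
        · simp
    have hG := fun (q : Fin k → ℕ) (hq : StrictMono q) => mul_rowDet_sum_smul z (W T) ih.1
      (fun i => {q i - 1, q i})
      (fun i j hij s hs t ht => by
        have := hq hij
        simp only [Finset.mem_insert, Finset.mem_singleton] at hs ht
        omega)
      (fun i s => if s = q i then (1 : ℝ) else if T < q i then ε else 0)
      (fun i s _ => by split_ifs; exacts [zero_le_one, hε.le, le_rfl])
    refine ⟨fun q hq => ?_, fun q hq h1 => ?_⟩
    · rw [hrow]
      exact (hG q hq).1
    · rw [hrow]
      -- Only indices above `i + T` descend; they exceed `T`, so their weight is `ε` and not the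
      -- cut-off `0`.
      have hmono : StrictMono fun i => min (q i) (i + T) := fun i j hij => by
        have := hq hij
        have : (i : ℕ) < j := hij
        dsimp only
        omega
      refine (hG q hq).2 (fun i => min (q i) (i + T)) hmono (fun i => ?_) (fun i => ?_)
        (ih.2 _ hmono (fun i => min_le_right _ _))
      · have := h1 i
        simp only [Finset.mem_insert, Finset.mem_singleton]
        omega
      · split_ifs
        · exact zero_lt_one
        · exact hε
        · exfalso
          have := h1 i
          omega

section

open Filter Topology Polynomial

/-- The linear functional on polynomials with moments `γ`. -/
noncomputable def momentFunctional (γ : ℕ → ℂ) : ℂ[X] →ₗ[ℂ] ℂ :=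
  (Polynomial.basisMonomials ℂ).constr ℂ γ

theorem momentFunctional_X_pow (γ : ℕ → ℂ) (s : ℕ) : momentFunctional γ (X ^ s) = γ s := by
  rw [← Polynomial.monomial_one_right_eq_X_pow]
  have := (Polynomial.basisMonomials ℂ).constr_basis ℂ γ s
  rwa [Polynomial.coe_basisMonomials] at this

theorem map_add_C_mul (L : ℂ[X] →ₗ[ℂ] ℂ) (f g : ℂ[X]) (c : ℂ) :
    L (f + C c * g) = L f + c * L g := by
  rw [map_add, ← smul_eq_C_mul, map_smul, smul_eq_mul]

theorem continuous_perturbation (L : ℂ[X] →ₗ[ℂ] ℂ) (T a : ℕ) :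
    Continuous fun ε : ℝ => L ((1 + C (ε : ℂ) * X) ^ T * (X + C (ε : ℂ)) ^ a) := by
  induction T generalizing L with
  | zero =>
    induction a generalizing L with
    | zero => simpa using continuous_const
    | succ a ih =>
      have h1 := ih (L ∘ₗ LinearMap.mulLeft ℂ X)
      have h2 := (Complex.continuous_ofReal).mul (ih L)
      refine (h1.add h2).congr fun ε => ?_
      rw [Pi.add_apply, Pi.mul_apply]
      simp only [LinearMap.comp_apply, LinearMap.mulLeft_apply, pow_zero, one_mul]
      rw [← map_add_C_mul, pow_succ]
      congr 1
      ring
  | succ T ih =>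
    have h1 := ih (L ∘ₗ LinearMap.mulLeft ℂ X)
    have h2 := (Complex.continuous_ofReal).mul h1
    refine ((ih L).add h2).congr fun ε => ?_
    rw [Pi.add_apply, Pi.mul_apply]
    simp only [LinearMap.comp_apply, LinearMap.mulLeft_apply]
    rw [← map_add_C_mul, pow_succ]
    congr 1
    ring

/-- The substitution `x ↦ x + ε` acts on the first `k` columns by a unitriangular matrix. -/
theorem rowDet_mul_X_add_C_pow {k : ℕ} (L : ℂ[X] →ₗ[ℂ] ℂ) (ε : ℂ) (f : Fin k → ℂ[X]) :
    rowDet (fun (i j : Fin k) => L ((X + C ε) ^ (j : ℕ) * f i)) =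
      rowDet (fun (i j : Fin k) => L (X ^ (j : ℕ) * f i)) := by
  let U : Matrix (Fin k) (Fin k) ℂ := Matrix.of fun l j => ((X + C ε) ^ (j : ℕ)).coeff l
  have hU : U.det = 1 := by
    rw [Matrix.det_of_isUpperTriangular]
    · refine Finset.prod_eq_one fun i _ => ?_
      simp [U, Polynomial.coeff_X_add_C_pow]
    · intro l j hjl
      have : (j : ℕ) < l := hjl
      simp [U, Polynomial.coeff_X_add_C_pow, Nat.choose_eq_zero_of_lt this]
  have := Matrix.det_mul (Matrix.of fun (i j : Fin k) => L (X ^ (j : ℕ) * f i)) U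
  rw [hU, mul_one] at this
  change Matrix.det _ = (Matrix.of fun (i j : Fin k) => L (X ^ (j : ℕ) * f i)).det
  rw [← this]
  congr 1
  ext i j
  have hdeg : ((X + C ε) ^ (j : ℕ)).natDegree < k := by
    rw [Polynomial.natDegree_pow, Polynomial.natDegree_X_add_C, mul_one]
    exact j.isLt
  conv_lhs => rw [Polynomial.as_sum_range_C_mul_X_pow' ((X + C ε) ^ (j : ℕ)) hdeg]
  have hsum := Fin.sum_univ_eq_sum_range
    (fun l : ℕ => L (C (((X + C ε) ^ (j : ℕ)).coeff l) * X ^ l * f i)) k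
  rw [Finset.sum_mul, map_sum, Matrix.mul_apply, ← hsum]
  refine Finset.sum_congr rfl fun l _ => ?_
  rw [mul_assoc, ← smul_eq_C_mul, map_smul, smul_eq_mul, mul_comm]
  rfl

theorem hankelMinor_nonneg_of_pos {k : ℕ}
    (hstrict : ∀ (γ : ℕ → ℂ) (z : ℂ),
      (∀ q : Fin k → ℕ, StrictMono q → 0 < z * hankelMinor γ q (fun i => i)) →
      ∀ p q : Fin k → ℕ, StrictMono p → StrictMono q → 0 < z * hankelMinor γ p q)
    (γ : ℕ → ℂ) (z : ℂ)
    (h : ∀ q : Fin k → ℕ, StrictMono q → 0 ≤ z * hankelMinor γ q (fun i => i))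
    (p q : Fin k → ℕ) (hp : StrictMono p) (hq : StrictMono q) :
    0 ≤ z * hankelMinor γ p q := by
  by_cases hz : z = 0
  · simp [hz]
  by_cases hall : ∀ u : Fin k → ℕ, StrictMono u → hankelMinor γ u (fun i => i) = 0
  · rw [hankelMinor_eq_zero hall, mul_zero]
  push Not at hall
  obtain ⟨u, hu, hune⟩ := hall
  have hupos : 0 < z * hankelMinor γ u (fun i => i) :=
    lt_of_le_of_ne (h u hu) (mul_ne_zero hz hune).symm
  let L := momentFunctional γ
  let row : ℂ[X] → Fin k → ℂ := fun f j => L (X ^ (j : ℕ) * f)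
  have row_add : ∀ f (c : ℂ) g, row (f + C c * g) = row f + c • row g := by
    intro f c g
    funext j
    simp only [row, Pi.add_apply, Pi.smul_apply]
    rw [smul_eq_mul, ← map_add_C_mul]
    congr 1
    ring
  have hrow0 : ∀ r : Fin k → ℕ, rowDet (fun i => row (X ^ r i)) = hankelMinor γ r (fun i => i) := by
    intro r
    unfold hankelMinor
    congr 1
    ext i j
    simp only [row]
    rw [← pow_add, momentFunctional_X_pow, add_comm]
  obtain ⟨T, hT⟩ : ∃ T, ∀ i, u i ≤ T :=
    ⟨∑ i, u i, fun i => Finset.single_le_sum (fun _ _ => Nat.zero_le _) (Finset.mem_univ i)⟩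
  -- The factor `(1 + ε X) ^ T` makes the initial minor positive, by reaching the nonzero minor `u`;
  -- the powers of `X + ε` spread this to all rows. The perturbed matrix is still Hankel.
  let γ' : ℝ → ℕ → ℂ := fun ε a => L ((1 + C (ε : ℂ) * X) ^ T * (X + C (ε : ℂ)) ^ a)
  have hγ' : ∀ ε : ℝ, 0 < ε → ∀ r : Fin k → ℕ, StrictMono r →
      0 < z * hankelMinor (γ' ε) r (fun i => i) := by
    intro ε hε r hr
    have hA := mul_rowDet_of_upper_bidiagonal (z := z) hε
      (fun t a => row ((1 + C (ε : ℂ) * X) ^ t * X ^ a))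
      (fun t a => by
        rw [← row_add]
        congr 1
        ring)
      (fun r hr => by
        simp only [pow_zero, one_mul, hrow0]
        exact h r hr) T
    have hA0 := hA.2 (fun i => i) u Fin.val_strictMono hu (val_le_of_strictMono hu)
      (fun i => (hT i).trans (Nat.le_add_left _ _)) (by
        simp only [pow_zero, one_mul, hrow0]
        exact hupos)
    obtain ⟨N, hN⟩ : ∃ N, ∀ i, r i ≤ N :=
      ⟨∑ i, r i, fun i => Finset.single_le_sum (fun _ _ => Nat.zero_le _) (Finset.mem_univ i)⟩
    have hB := mul_rowDet_of_lower_bidiagonal (z := z) hε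
      (fun t a => row ((1 + C (ε : ℂ) * X) ^ T * (X ^ (a - t) * (X + C (ε : ℂ)) ^ min a t)))
      (fun t a => by
        rw [← row_add]
        congr 1
        split_ifs with hta
        · rw [show a - t = (a - (t + 1)) + 1 by omega, show min a (t + 1) = t + 1 by omega,
            show min a t = t by omega, show min (a - 1) t = t by omega,
            show a - 1 - t = a - (t + 1) by omega]
          ring
        · rw [show a - t = 0 by omega, show min a (t + 1) = a by omega,
            show min a t = a by omega, show a - (t + 1) = 0 by omega]
          simp)
      (fun r hr => by
        simp only [Nat.sub_zero, Nat.min_zero, pow_zero, mul_one]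
        exact hA.1 r hr)
      (by
        simp only [Nat.sub_zero, Nat.min_zero, pow_zero, mul_one]
        exact hA0) N
    -- After `N` steps, with every `r i ≤ N`, row `r i` has become the full power `(X + ε) ^ r i`.
    have hfin := hB.2 r hr fun i => (hN i).trans (Nat.le_add_left _ _)
    have e1 : hankelMinor (γ' ε) r (fun i => i) =
        rowDet fun (i j : Fin k) => L ((X + C (ε : ℂ)) ^ (j : ℕ) *
          ((1 + C (ε : ℂ) * X) ^ T * (X + C (ε : ℂ)) ^ r i)) := by
      unfold hankelMinor
      congr 1
      ext i j
      simp only [γ']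
      congr 1
      ring
    rw [e1, rowDet_mul_X_add_C_pow]
    convert hfin using 3
    funext i
    rw [Nat.sub_eq_zero_of_le (hN i), min_eq_left (hN i), pow_zero, one_mul]
  have hcont : Continuous fun ε : ℝ => z * hankelMinor (γ' ε) p q := by
    refine continuous_const.mul (Continuous.matrix_det (A := fun ε : ℝ =>
      Matrix.of fun (i j : Fin k) => γ' ε (p i + q j)) ?_)
    exact continuous_pi fun i => continuous_pi fun j => continuous_perturbation L T _
  have hzero : γ' 0 = γ := by
    funext a
    simp only [γ', Complex.ofReal_zero, map_zero, zero_mul, add_zero, one_pow, one_mul]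
    exact momentFunctional_X_pow γ a
  have hlim := (hcont.tendsto 0).mono_left (nhdsWithin_le_nhds (s := Set.Ioi 0))
  rw [hzero] at hlim
  refine ge_of_tendsto hlim ?_
  filter_upwards [self_mem_nhdsWithin] with ε hε
  exact (hstrict _ z (hγ' ε hε) p q hp hq).le

theorem hankelMinor_pos {k : ℕ} (γ : ℕ → ℂ) (z : ℂ)
    (h : ∀ q : Fin k → ℕ, StrictMono q → 0 < z * hankelMinor γ q (fun i => i))
    (p q : Fin k → ℕ) (hp : StrictMono p) (hq : StrictMono q) :
    0 < z * hankelMinor γ p q := by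
  induction k generalizing γ z with
  | zero =>
    have := h q hq
    rwa [Subsingleton.elim p q, Subsingleton.elim q fun i => i] at *
  | succ k ih =>
    cases k with
    | zero =>
      have hp' : p = fun i : Fin 1 => p 0 + (i : ℕ) := by
        funext i
        rw [Fin.fin_one_eq_zero i]
        simp
      rw [hp', hankelMinor_consecutive]
      exact h _ fun i j hij => Nat.add_lt_add_right (hq hij) _
    | succ d =>
      exact hankelMinor_pos_succ ih (hankelMinor_nonneg_of_pos ih) h hp hq

theorem hankelMinor_nonneg {k : ℕ} (γ : ℕ → ℂ) (z : ℂ)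
    (h : ∀ q : Fin k → ℕ, StrictMono q → 0 ≤ z * hankelMinor γ q (fun i => i))
    (p q : Fin k → ℕ) (hp : StrictMono p) (hq : StrictMono q) :
    0 ≤ z * hankelMinor γ p q :=
  hankelMinor_nonneg_of_pos hankelMinor_pos γ z h p q hp hq

end

/-! ### Return to finite Hankel matrices. -/

/-- The sign is chosen separately for each `N`; nesting of the matrices makes one choice work for
all. -/
theorem forall_or_forall_of_antitone {k : ℕ} {A B : ℕ → Prop}
    (hA : ∀ M N, M ≤ N → A N → A M) (hB : ∀ M N, M ≤ N → B N → B M)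
    (h : ∀ N, k ≤ N → A N ∨ B N) : (∀ N, k ≤ N → A N) ∨ (∀ N, k ≤ N → B N) := by
  by_contra hne
  push Not at hne
  obtain ⟨⟨M, hM, hAM⟩, N, hN, hBN⟩ := hne
  rcases h (max M N) (hM.trans (le_max_left _ _)) with h1 | h1
  · exact hAM (hA _ _ (le_max_left _ _) h1)
  · exact hBN (hB _ _ (le_max_right _ _) h1)

theorem kMinor_hankelMatrix (g : ℤ → ℂ) {m n k : ℕ} (p : Fin k ↪o Fin m) (q : Fin k ↪o Fin n) :
    kMinor (hankelMatrix g 1 m n) p q =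
      hankelMinor (fun a => g (1 + (a : ℤ))) (fun i => p i) (fun j => q j) := by
  unfold kMinor hankelMinor
  change _ = Matrix.det (Matrix.of fun i j => g (1 + ((p i + q j : ℕ) : ℤ)))
  congr 1
  ext i j
  simp [hankelMatrix, add_assoc]

/-- Minors with the first `k` rows of the infinite Hankel matrix are minors of a finite block. -/
theorem exists_kMinor_eq_hankelMinor (g : ℤ → ℂ) {k : ℕ} {q : Fin k → ℕ} (hq : StrictMono q) :
    ∃ N, k ≤ N ∧ ∃ (p : Fin k ↪o Fin k) (q' : Fin k ↪o Fin N),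
      kMinor (hankelMatrix g 1 k N) p q' =
        hankelMinor (fun a => g (1 + (a : ℤ))) q (fun i => i) := by
  obtain ⟨T, hT⟩ : ∃ T, ∀ i, q i ≤ T :=
    ⟨∑ i, q i, fun i => Finset.single_le_sum (fun _ _ => Nat.zero_le _) (Finset.mem_univ i)⟩
  refine ⟨k + T + 1, by omega, OrderEmbedding.ofStrictMono id strictMono_id,
    OrderEmbedding.ofStrictMono (fun i => ⟨q i, by have := hT i; omega⟩) fun i j hij => hq hij, ?_⟩
  rw [kMinor_hankelMatrix, hankelMinor_comm]
  rfl

theorem kMinor_hankelMatrix_castLE_right (g : ℤ → ℂ) {k m M N : ℕ} (h : M ≤ N)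
    (p : Fin k ↪o Fin m) (q : Fin k ↪o Fin M) :
    kMinor (hankelMatrix g 1 m M) p q =
      kMinor (hankelMatrix g 1 m N) p (q.trans (Fin.castLEOrderEmb h)) := rfl

theorem kMinor_hankelMatrix_castLE_left (g : ℤ → ℂ) {k n M N : ℕ} (h : M ≤ N)
    (p : Fin k ↪o Fin M) (q : Fin k ↪o Fin n) :
    kMinor (hankelMatrix g 1 M n) p q =
      kMinor (hankelMatrix g 1 N n) (p.trans (Fin.castLEOrderEmb h)) q := rfl

theorem operatorSignConsistent_hankelOperator_iff (g : ℤ → ℂ) (k : ℕ) :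
    OperatorSignConsistent k (hankelOperator g) ↔
      ∀ N : ℕ, k ≤ N → SignConsistent k (hankelMatrix g 1 k N) := by
  constructor
  · intro h N hN
    have hb := h N hN
    rw [leadingBlock_hankelOperator] at hb
    refine hb.imp (fun hb p q => ?_) (fun hb p q => ?_)
    all_goals
      rw [kMinor_hankelMatrix_castLE_left g hN]
      exact hb _ _
  · intro h N hN
    rw [leadingBlock_hankelOperator]
    refine (forall_or_forall_of_antitone ?_ ?_ h).imp (fun h p q => ?_) (fun h p q => ?_)
    · intro M N hMN hb p q
      rw [kMinor_hankelMatrix_castLE_right g hMN]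
      exact hb _ _
    · intro M N hMN hb p q
      rw [kMinor_hankelMatrix_castLE_right g hMN]
      exact hb _ _
    · rw [kMinor_hankelMatrix]
      have := hankelMinor_nonneg (fun a => g (1 + (a : ℤ))) 1 (fun r hr => by
        obtain ⟨M, hM, p', q', e⟩ := exists_kMinor_eq_hankelMinor g hr
        rw [← e, one_mul]
        exact h M hM p' q') (fun i => p i) (fun i => q i) p.strictMono q.strictMono
      rwa [one_mul] at this
    · rw [kMinor_hankelMatrix]
      have := hankelMinor_nonneg (fun a => g (1 + (a : ℤ))) (-1) (fun r hr => by
        obtain ⟨M, hM, p', q', e⟩ := exists_kMinor_eq_hankelMinor g hr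
        rw [← e, neg_one_mul]
        exact neg_nonneg.2 (h M hM p' q')) (fun i => p i) (fun i => q i) p.strictMono q.strictMono
      rw [neg_one_mul] at this
      exact neg_nonneg.1 this

theorem operatorStrictlySignConsistent_hankelOperator_iff (g : ℤ → ℂ) (k : ℕ) :
    OperatorStrictlySignConsistent k (hankelOperator g) ↔
      ∀ N : ℕ, k ≤ N → StrictlySignConsistent k (hankelMatrix g 1 k N) := by
  constructor
  · intro h N hN
    have hb := h N hN
    rw [leadingBlock_hankelOperator] at hb
    refine hb.imp (fun hb p q => ?_) (fun hb p q => ?_)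
    all_goals
      rw [kMinor_hankelMatrix_castLE_left g hN]
      exact hb _ _
  · intro h N hN
    rw [leadingBlock_hankelOperator]
    refine (forall_or_forall_of_antitone ?_ ?_ h).imp (fun h p q => ?_) (fun h p q => ?_)
    · intro M N hMN hb p q
      rw [kMinor_hankelMatrix_castLE_right g hMN]
      exact hb _ _
    · intro M N hMN hb p q
      rw [kMinor_hankelMatrix_castLE_right g hMN]
      exact hb _ _
    · rw [kMinor_hankelMatrix]
      have := hankelMinor_pos (fun a => g (1 + (a : ℤ))) 1 (fun r hr => by
        obtain ⟨M, hM, p', q', e⟩ := exists_kMinor_eq_hankelMinor g hr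
        rw [← e, one_mul]
        exact h M hM p' q') (fun i => p i) (fun i => q i) p.strictMono q.strictMono
      rwa [one_mul] at this
    · rw [kMinor_hankelMatrix]
      have := hankelMinor_pos (fun a => g (1 + (a : ℤ))) (-1) (fun r hr => by
        obtain ⟨M, hM, p', q', e⟩ := exists_kMinor_eq_hankelMinor g hr
        rw [← e, neg_one_mul]
        exact neg_pos.2 (h M hM p' q')) (fun i => p i) (fun i => q i) p.strictMono q.strictMono
      rw [neg_one_mul] at this
      exact neg_pos.1 this

end KSign

theorem mainTheorem2 (g : ℤ → ℂ) (k : ℕ) (hk : 1 ≤ k) :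
    (KSign.OperatorSignConsistent k (KSign.hankelOperator g) ↔
      ∀ N : ℕ, k ≤ N → KSign.SignConsistent k (KSign.hankelMatrix g 1 k N)) ∧
    (KSign.OperatorStrictlySignConsistent k (KSign.hankelOperator g) ↔
      ∀ N : ℕ, k ≤ N → KSign.StrictlySignConsistent k (KSign.hankelMatrix g 1 k N)) :=
  ⟨KSign.operatorSignConsistent_hankelOperator_iff g k,
    KSign.operatorStrictlySignConsistent_hankelOperator_iff g k⟩
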